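/- Let $K$ be an algebraically closed field, let $n_1,\dots,n_r$ and $d_1,\dots,d_r$ be positive integers, and let $N=\prod_{i=1}^r\binom{n_i+d_i}{n_i}-1$. Let $SV_{\boldsymbol d}^{\boldsymbol n}\subset\mathbb{P}^N$ be the Segre-Veronese variety over $K$, that is, the image of $\mathbb{P}^{n_1}\times\dots\times\mathbb{P}^{n_r}$ under the embedding given by the complete linear system of $\mathcal{O}(d_1,\dots,d_r)$. For a smooth, irreducible, non-degenerate projective variety $X\subset\mathbb{P}^N$ of dimension $n$ and an integer $h\ge 0$, the $h$-th Terracini locus $T_h(X)$ is the (Zariski) closure in the symmetric product $X^h/S_h$ of the set of all $\{x_1,\dots,x_h\}$ such that $x_i\neq x_j$ for $i\neq j$ and $$\dim\langle T_{x_1}X,\dots,T_{x_h}X\rangle<\min\{hn+h-1,\,N\},$$ where $T_xX\subset\mathbb{P}^N$ is the embedded projective tangent space of $X$ at $x$. If $h\le\lceil d_i/2\rceil$ for all $i=1,\dots,r$, then $T_h(SV_{\boldsymbol d}^{\boldsymbol n})=\emptyset$. -/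

import Mathlib

open scoped LinearAlgebra.Projectivization

noncomputable section

namespace Terracini

section General

variable {K : Type*} [Field K] {σ : Type*}

/-- The affine cone over a subset `X` of the projective space with homogeneous coordinates indexed
by `σ`: the origin, and all coordinate vectors of points of `X`. -/
def affineCone (X : Set (ℙ K (σ → K))) : Set (σ → K) :=
  {v | ∀ hv : v ≠ 0, Projectivization.mk K v hv ∈ X}

/-- The homogeneous ideal `I(X)`: all polynomials that vanish at every coordinate vector of every
point of `X`. (Over an infinite field this ideal is homogeneous.) -/
def idealOf (X : Set (ℙ K (σ → K))) : Ideal (MvPolynomial σ K) :=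
  MvPolynomial.vanishingIdeal K (affineCone X)

/-- The dimension of an irreducible projective variety `X`: the transcendence degree over `K` of the
homogeneous coordinate ring, minus one. -/
def projDim (X : Set (ℙ K (σ → K))) : ℤ :=
  (Cardinal.toNat (Algebra.trdeg K (MvPolynomial σ K ⧸ idealOf X)) : ℤ) - 1

/-- The projective dimension of the linear subspace of projective space given by a linear
subspace `W` of the vector space of coordinate vectors. -/
def linDim (W : Submodule K (σ → K)) : ℤ :=
  (Module.finrank K W : ℤ) - 1

/-- The embedded projective tangent space of `X` at `x`, given by its linear subspace of
coordinate vectors `w`: those with `∑ j, w j * (∂F/∂z_j)(x) = 0` for all `F` in `I(X)`. -/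
def tangentSpace [Fintype σ] (X : Set (ℙ K (σ → K))) (x : ℙ K (σ → K)) :
    Submodule K (σ → K) where
  carrier := {w | ∀ F ∈ idealOf X,
    ∑ j, w j * MvPolynomial.eval x.rep (MvPolynomial.pderiv j F) = 0}
  add_mem' := by
    intro a b ha hb F hF
    simp only [Pi.add_apply, add_mul, Finset.sum_add_distrib, ha F hF, hb F hF, add_zero]
  zero_mem' := by
    intro F _
    simp
  smul_mem' := by
    intro c a ha F hF
    simp only [Pi.smul_apply, smul_eq_mul, mul_assoc, ← Finset.mul_sum, ha F hF, mul_zero]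

/-- The Zariski topology on the `h`-fold product of the projective space (not the product of the
Zariski topologies of the factors): the sets where a multihomogeneous polynomial in the `h` groups
of variables does not vanish form a basis of open sets. -/
@[reducible] def zariskiProd (K : Type*) [Field K] (σ : Type*) (h : ℕ) :
    TopologicalSpace (Fin h → ℙ K (σ → K)) :=
  TopologicalSpace.generateFrom
    {U | ∃ (F : MvPolynomial (Fin h × σ) K) (δ : Fin h → ℕ),
      F.IsWeightedHomogeneous (fun ij : Fin h × σ => (Pi.single ij.1 1 : Fin h → ℕ)) δ ∧
      U = {x | MvPolynomial.eval (fun ij : Fin h × σ => (x ij.1).rep ij.2) F ≠ 0}}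

/-- The quotient map from the `h`-fold product of `X` to the `h`-th symmetric product. -/
def toSym {α : Type*} (h : ℕ) (f : Fin h → α) : Sym α h :=
  ⟨Finset.univ.val.map f, by simp⟩

/-- The Zariski topology on the symmetric product `X^h / S_h`: the quotient topology of the
subspace topology on `X^h`. -/
@[reducible] def zariskiSym (X : Set (ℙ K (σ → K))) (h : ℕ) : TopologicalSpace (Sym X h) :=
  TopologicalSpace.coinduced (toSym h)
    (TopologicalSpace.induced (fun (f : Fin h → X) (i : Fin h) => (f i : ℙ K (σ → K)))
      (zariskiProd K σ h))

/-- The set of unordered `h`-tuples of distinct points of `X ⊆ ℙ^N` at which the tangent spaces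
span a linear space of dimension less than `min {h n + h - 1, N}`, where `n = dim X`. -/
def openTerraciniLocus [Fintype σ] (X : Set (ℙ K (σ → K))) (h : ℕ) : Set (Sym X h) :=
  {s | (s : Multiset X).Nodup ∧
    linDim (⨆ x ∈ s, tangentSpace X (x : ℙ K (σ → K))) <
      min ((h : ℤ) * projDim X + h - 1) ((Fintype.card σ : ℤ) - 1)}

/-- The `h`-th Terracini locus of `X`: the closure of the above set in `X^h / S_h`. -/
def terraciniLocus [Fintype σ] (X : Set (ℙ K (σ → K))) (h : ℕ) : Set (Sym X h) :=
  @closure _ (zariskiSym X h) (openTerraciniLocus X h)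

end General

section SegreVeronese

variable (K : Type*) [Field K] {r : ℕ} (n d : Fin r → ℕ)

/-- The monomials of multidegree `(d_1, …, d_r)` in `r` groups of variables, the `i`-th group having
`n_i + 1` variables: a multiset of `d_i` variables of the `i`-th group for each `i`. -/
abbrev Monomials : Type := (i : Fin r) → Sym (Fin (n i + 1)) (d i)

variable {K n} in
/-- The vector of all monomials of multidegree `(d_1, …, d_r)`, evaluated at `v`. -/
def monomialVector (v : (i : Fin r) → Fin (n i + 1) → K) : Monomials n d → K :=
  fun e => ∏ i, ((e i : Multiset (Fin (n i + 1))).map (v i)).prod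

variable {K n} in
theorem monomialVector_ne_zero (v : (i : Fin r) → Fin (n i + 1) → K) (hv : ∀ i, v i ≠ 0) :
    monomialVector d v ≠ 0 := by
  have h1 : ∀ i, ∃ j, v i j ≠ 0 := fun i => Function.ne_iff.mp (hv i)
  choose j hj using h1
  intro h0
  have h2 := congrFun h0 (fun i => Sym.replicate (d i) (j i))
  simp only [monomialVector, Sym.coe_replicate, Multiset.map_replicate, Multiset.prod_replicate,
    Pi.zero_apply] at h2
  exact Finset.prod_ne_zero_iff.mpr (fun i _ => pow_ne_zero (d i) (hj i)) h2

/-- The morphism `ℙ^{n_1} × ⋯ × ℙ^{n_r} → ℙ^{N(n,d)}` given by the complete linear system of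
`𝒪(d_1, …, d_r)`, that is, by all monomials of multidegree `(d_1, …, d_r)`. -/
def segreVeroneseMap (p : (i : Fin r) → ℙ K (Fin (n i + 1) → K)) : ℙ K (Monomials n d → K) :=
  Projectivization.mk K (monomialVector d fun i => (p i).rep)
    (monomialVector_ne_zero d _ fun i => (p i).rep_nonzero)

/-- The Segre-Veronese variety. -/
def segreVeronese : Set (ℙ K (Monomials n d → K)) :=
  Set.range (segreVeroneseMap K n d)

end SegreVeronese

end Terracini

end

open scoped LinearAlgebra.Projectivization

namespace Terracini

open TrivSqZeroExt

/-! The tangent spaces at `h` distinct points are shown to be independent by exhibiting dual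
hypersurface sections. A functional on the ambient space is a form of multidegree `d`, and pairing
it with a tangent vector takes the `ε`-part of that form at a point over the dual numbers. Fix one
point. Each other point differs from it in some factor, so a linear form in that factor vanishes at
the other point only; its square makes the product singular there. This uses degree at most `2(h -
1)` in each factor, and `h ≤ ⌈d i / 2⌉` leaves at least one more linear form, chosen to detect one
tangent direction (`exists_separating_functional`). So the span has vector space dimension at least
`h(∑ n i + 1)`. Since `projDim` is at most `∑ n i` (`projDim_segreVeronese_le`), the defining
inequality never holds, and the closure of the empty set is empty. -/

/-- The vector of all monomials of multidegree `d`, with values in any commutative monoid. -/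
def monomials {A : Type*} [CommMonoid A] {r : ℕ} {n : Fin r → ℕ} (d : Fin r → ℕ)
    (v : (i : Fin r) → Fin (n i + 1) → A) : Monomials n d → A :=
  fun e => ∏ i, ((e i : Multiset (Fin (n i + 1))).map (v i)).prod

theorem map_monomials {A B F : Type*} [CommMonoid A] [CommMonoid B] [FunLike F A B]
    [MonoidHomClass F A B] (f : F) {r : ℕ} {n : Fin r → ℕ} (d : Fin r → ℕ)
    (v : (i : Fin r) → Fin (n i + 1) → A) (e : Monomials n d) :
    f (monomials d v e) = monomials d (fun i b => f (v i b)) e := by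
  simp only [monomials, map_prod, map_multiset_prod, Multiset.map_map]
  rfl

theorem monomials_mul {A : Type*} [CommMonoid A] {r : ℕ} {n : Fin r → ℕ} (d : Fin r → ℕ)
    (c : Fin r → A) (v : (i : Fin r) → Fin (n i + 1) → A) (e : Monomials n d) :
    monomials d (fun i b => c i * v i b) e = (∏ i, c i ^ d i) * monomials d v e := by
  simp only [monomials, Multiset.prod_map_mul, Finset.prod_mul_distrib, Multiset.map_const',
    Multiset.prod_replicate, Sym.card_coe]

theorem exists_toSym_eq {α : Type*} {m : ℕ} (s : Sym α m) : ∃ f : Fin m → α, toSym m f = s := by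
  obtain ⟨s, hs⟩ := s
  induction s using Quotient.inductionOn with
  | h l =>
    have hl : l.length = m := by simpa using hs
    subst hl
    refine ⟨l.get, Subtype.ext ?_⟩
    simp [toSym]

/-! ### Products of linear forms as functionals -/

section Forms

variable {K : Type*} [Field K] {r : ℕ} {n : Fin r → ℕ}

/-- The value of the linear form with coefficients `l` at a vector over a `K`-algebra. -/
def linEval {A : Type*} [CommRing A] [Algebra K A] {m : ℕ} (l : Fin m → K) (v : Fin m → A) : A :=
  ∑ a, algebraMap K A (l a) * v a

/-- A multihomogeneous product of linear forms is a linear combination of the monomials. -/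
theorem exists_sum_monomials_eq_prod_linEval (A : Type*) [CommRing A] [Algebra K A]
    (d : Fin r → ℕ) (S : (i : Fin r) → Sym (Fin (n i + 1) → K) (d i)) :
    ∃ c : Monomials n d → K, ∀ v : (i : Fin r) → Fin (n i + 1) → A,
      ∑ e, algebraMap K A (c e) * monomials d v e =
        ∏ i, ((S i : Multiset (Fin (n i + 1) → K)).map fun l => linEval l (v i)).prod := by
  classical
  choose f hf using fun i => exists_toSym_eq (S i)
  -- `F` picks one variable from each linear factor; choices giving the same monomial are added, so
  -- no multinomial coefficient is divided out.
  refine ⟨fun e => ∑ F : (i : Fin r) → Fin (d i) → Fin (n i + 1) with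
    (fun i => toSym (d i) (F i)) = e, ∏ i, ∏ j, f i j (F i j), fun v => ?_⟩
  have h1 : ∀ i, ((S i : Multiset (Fin (n i + 1) → K)).map fun l => linEval l (v i)).prod =
      ∑ g : Fin (d i) → Fin (n i + 1), ∏ j, algebraMap K A (f i j (g j)) * v i (g j) := by
    intro i
    rw [← hf i]
    simp only [toSym, Sym.coe_mk, Multiset.map_map, linEval]
    change ∏ j, _ = _
    simp only [Function.comp_apply]
    rw [Finset.prod_univ_sum, Fintype.piFinset_univ]
  simp only [h1]
  rw [Finset.prod_univ_sum, Fintype.piFinset_univ,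
    ← Finset.sum_fiberwise Finset.univ (fun F : (i : Fin r) → Fin (d i) → Fin (n i + 1) =>
      (fun i => toSym (d i) (F i) : Monomials n d))]
  refine Finset.sum_congr rfl fun e _ => ?_
  rw [map_sum, Finset.sum_mul]
  refine Finset.sum_congr rfl fun F hF => ?_
  rw [← (Finset.mem_filter.mp hF).2]
  simp only [monomials, toSym, Sym.coe_mk, Multiset.map_map, map_prod, Finset.prod_mul_distrib]
  rfl

end Forms

/-! ### Tangent vectors over the dual numbers and their independence -/

section Jets

variable {K : Type*} [Field K] {r : ℕ} {n : Fin r → ℕ}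

/-- The directions used to parametrise the tangent space: `none` is the radial one, and
`some ⟨i, b⟩` moves in the `i`-th factor along a coordinate other than the pivot `a i`. -/
def direction (K : Type*) [Field K] (a : (i : Fin r) → Fin (n i + 1)) :
    Option (Σ i, Fin (n i)) → (i : Fin r) → Fin (n i + 1) → K
  | none => 0
  | some t => Pi.single t.1 (Pi.single ((a t.1).succAbove t.2) 1)

/-- The first order deformation of `v` along a direction. -/
def jetPoint (v : (i : Fin r) → Fin (n i + 1) → K) (a : (i : Fin r) → Fin (n i + 1))
    (t : Option (Σ i, Fin (n i))) (i : Fin r) (b : Fin (n i + 1)) : DualNumber K :=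
  inl (v i b) + inr (direction K a t i b)

/-- The first order deformation of the scalar `c`, constant except in the radial direction. -/
def jetScalar (c : K) (t : Option (Σ i, Fin (n i))) : DualNumber K :=
  inl c + inr (if t = none then 1 else 0)

/-- The tangent vector of the cone over the Segre-Veronese variety at `c` times the image of `v`. -/
def tangentVector (d : Fin r → ℕ) (c : K) (v : (i : Fin r) → Fin (n i + 1) → K)
    (a : (i : Fin r) → Fin (n i + 1)) (t : Option (Σ i, Fin (n i))) : Monomials n d → K :=
  fun e => (jetScalar c t * monomials d (jetPoint v a t) e).snd

theorem fst_jetScalar (c : K) (t : Option (Σ i, Fin (n i))) : (jetScalar c t).fst = c := by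
  rw [jetScalar, fst_add, fst_inl, fst_inr, add_zero]

theorem fst_linEval_jetPoint (v : (i : Fin r) → Fin (n i + 1) → K)
    (a : (i : Fin r) → Fin (n i + 1)) (t : Option (Σ i, Fin (n i))) (i : Fin r)
    (l : Fin (n i + 1) → K) :
    (linEval l (jetPoint v a t i)).fst = l ⬝ᵥ v i := by
  simp [linEval, jetPoint, dotProduct, TrivSqZeroExt.algebraMap_eq_inl, fst_sum]

theorem snd_linEval_jetPoint (v : (i : Fin r) → Fin (n i + 1) → K)
    (a : (i : Fin r) → Fin (n i + 1)) (t : Option (Σ i, Fin (n i))) (i : Fin r)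
    (l : Fin (n i + 1) → K) :
    (linEval l (jetPoint v a t i)).snd = l ⬝ᵥ direction K a t i := by
  simp [linEval, jetPoint, dotProduct, TrivSqZeroExt.algebraMap_eq_inl, snd_sum]

theorem exists_functional_tangentVector (d : Fin r → ℕ)
    (S : (i : Fin r) → Sym (Fin (n i + 1) → K) (d i)) :
    ∃ f : (Monomials n d → K) →ₗ[K] K, ∀ c v a t,
      f (tangentVector d c v a t) = (jetScalar c t *
        ∏ i, ((S i : Multiset (Fin (n i + 1) → K)).map
          fun l => linEval l (jetPoint v a t i)).prod).snd := by
  obtain ⟨c, hc⟩ := exists_sum_monomials_eq_prod_linEval (DualNumber K) d S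
  refine ⟨∑ e, c e • LinearMap.proj e, fun c' v a t => ?_⟩
  rw [← hc, Finset.mul_sum, snd_sum]
  simp only [LinearMap.sum_apply, LinearMap.smul_apply, LinearMap.proj_apply, tangentVector]
  refine Finset.sum_congr rfl fun e _ => ?_
  rw [mul_left_comm, TrivSqZeroExt.algebraMap_eq_inl]
  simp

/-- A linear form that vanishes at `w` but not at `v`. -/
theorem exists_linear_form {m : ℕ} (v w : Fin m → K) (hv : v ≠ 0) (hw : w ≠ 0)
    (h : Projectivization.mk K v hv ≠ Projectivization.mk K w hw) :
    ∃ l : Fin m → K, l ⬝ᵥ w = 0 ∧ l ⬝ᵥ v ≠ 0 := by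
  by_contra! H
  obtain ⟨j, hj⟩ := Function.ne_iff.mp hw
  simp only [Pi.zero_apply] at hj
  have key : ∀ b, w j * v b = v j * w b := by
    intro b
    -- The test forms are the `2 × 2` minors with `w`; if all vanish at `v`, then `v` is
    -- proportional to `w`.
    have := H (Pi.single b (w j) - Pi.single j (w b))
      (by simp [sub_dotProduct]; ring)
    simp [sub_dotProduct] at this
    linear_combination this
  apply h
  rw [Projectivization.mk_eq_mk_iff']
  refine ⟨v j / w j, funext fun b => ?_⟩
  simp only [Pi.smul_apply, smul_eq_mul]
  field_simp
  linear_combination -key b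

/-- Multidegree `d` forms, singular at all the points other than the `k`-th one, whose differentials
at the `k`-th one are dual to the tangent vectors. -/
theorem exists_separating_functional {ι : Type*} [Fintype ι] (d : Fin r → ℕ)
    (hd : ∀ i, 2 * Fintype.card ι ≤ d i + 1)
    (c : ι → K) (hc : ∀ k, c k ≠ 0) (v : ι → (i : Fin r) → Fin (n i + 1) → K)
    (hv : ∀ k i, v k i ≠ 0)
    (hdist : ∀ k l, k ≠ l → ∃ i, Projectivization.mk K (v k i) (hv k i) ≠
      Projectivization.mk K (v l i) (hv l i))
    (a : ι → (i : Fin r) → Fin (n i + 1)) (ha : ∀ k i, v k i (a k i) ≠ 0)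
    (k : ι) (t : Option (Σ i, Fin (n i))) :
    ∃ f : (Monomials n d → K) →ₗ[K] K,
      (∀ l ≠ k, ∀ s, f (tangentVector d (c l) (v l) (a l) s) = 0) ∧
      f (tangentVector d (c k) (v k) (a k) t) ≠ 0 ∧
      (t ≠ none → ∀ s ≠ t, f (tangentVector d (c k) (v k) (a k) s) = 0) := by
  classical
  have h1 : ∀ l : {l // l ≠ k}, ∃ i, ∃ L : Fin (n i + 1) → K,
      L ⬝ᵥ v l i = 0 ∧ L ⬝ᵥ v k i ≠ 0 := by
    intro l
    obtain ⟨i, hi⟩ := hdist k l l.2.symm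
    exact ⟨i, exists_linear_form _ _ _ _ hi⟩
  choose idx L hL0 hL1 using h1
  -- the forms through the other points, grouped by factor
  let Q : (i : Fin r) → Multiset (Fin (n i + 1) → K) := fun i =>
    (Finset.univ : Finset {l : {l // l ≠ k} // idx l = i}).val.map
      fun l : {l : {l // l ≠ k} // idx l = i} => l.2 ▸ L l.1
  have hQcard : ∀ i, 2 * (Q i).card + 1 ≤ d i := by
    intro i
    have h2 : (Q i).card = Fintype.card {l : {l // l ≠ k} // idx l = i} := by
      simp only [Q, Multiset.card_map]; rfl
    have h3 := Fintype.card_subtype_le (fun l : {l // l ≠ k} => idx l = i)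
    have h4 : Fintype.card {l // l ≠ k} = Fintype.card ι - 1 := by
      simp [Fintype.card_subtype_compl]
    have h5 : 0 < Fintype.card ι := Fintype.card_pos_iff.mpr ⟨k⟩
    have := hd i
    omega
  have hQk : ∀ i, ∀ l ∈ Q i, l ⬝ᵥ v k i ≠ 0 := by
    intro i l hl
    simp only [Q, Multiset.mem_map] at hl
    obtain ⟨⟨x, rfl⟩, -, rfl⟩ := hl
    exact hL1 x
  have hQl : ∀ l : {l // l ≠ k}, ∃ q ∈ Q (idx l), q ⬝ᵥ v l (idx l) = 0 := by
    intro l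
    refine ⟨L l, ?_, hL0 l⟩
    simp only [Q, Multiset.mem_map]
    exact ⟨⟨l, rfl⟩, Finset.mem_univ _, rfl⟩
  let M : (i : Fin r) → Fin (n i + 1) → K := fun i => Pi.single (a k i) 1
  -- For `some ⟨j, b⟩`, the `j`-th form kills `v k j` and, among the coordinate directions of factor
  -- `j`, sees only `b`.
  let N : (i : Fin r) → Fin (n i + 1) → K := match t with
    | none => M
    | some ⟨j, b⟩ => Function.update M j (Pi.single ((a k j).succAbove b) 1 -
        Pi.single (a k j) (v k j ((a k j).succAbove b) / v k j (a k j)))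
  -- The pivot form `M i`, nonzero at the `k`-th point, fills up the degree.
  let S : (i : Fin r) → Multiset (Fin (n i + 1) → K) := fun i =>
    N i ::ₘ (2 • Q i + Multiset.replicate (d i - 1 - 2 * (Q i).card) (M i))
  have hS : ∀ i, (S i).card = d i := by
    intro i
    have := hQcard i
    simp only [S, Multiset.card_cons, Multiset.card_add, Multiset.card_nsmul,
      Multiset.card_replicate]
    omega
  obtain ⟨f, hf⟩ := exists_functional_tangentVector d (fun i => (⟨S i, hS i⟩ : Sym _ (d i)))
  -- the factors other than the one coming from `N`
  let R : (i : Fin r) → (Fin (n i + 1) → DualNumber K) → DualNumber K := fun i V =>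
    ((Q i).map fun l => linEval l V).prod ^ 2 * linEval (M i) V ^ (d i - 1 - 2 * (Q i).card)
  have hf' : ∀ l s, f (tangentVector d (c l) (v l) (a l) s) =
      (jetScalar (c l) s * ∏ i, (linEval (N i) (jetPoint (v l) (a l) s i) *
        R i (jetPoint (v l) (a l) s i))).snd := by
    intro l s
    rw [hf]
    simp only [S, R, Sym.coe_mk, Multiset.map_cons, Multiset.prod_cons, Multiset.map_add,
      Multiset.map_nsmul, Multiset.prod_add, Multiset.prod_nsmul, Multiset.map_replicate,
      Multiset.prod_replicate]
  have hR : ∀ s i, (R i (jetPoint (v k) (a k) s i)).fst ≠ 0 := by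
    intro s i
    have h6 : ((Q i).map fun l => linEval l (jetPoint (v k) (a k) s i)).prod.fst =
        ((Q i).map fun l => l ⬝ᵥ v k i).prod := by
      rw [← fstHom_apply K K, map_multiset_prod, Multiset.map_map]
      simp only [Function.comp_apply, fstHom_apply, fst_linEval_jetPoint]
    simp only [R, fst_mul, fst_pow, h6, fst_linEval_jetPoint, M, single_dotProduct, one_mul]
    refine mul_ne_zero (pow_ne_zero _ ?_) (pow_ne_zero _ (ha k i))
    rw [Ne, Multiset.prod_eq_zero_iff, Multiset.mem_map]
    rintro ⟨l, hl, h0⟩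
    exact hQk i l hl h0
  have hM : ∀ s i, (linEval (M i) (jetPoint (v k) (a k) s i)).fst ≠ 0 := by
    intro s i
    simp only [fst_linEval_jetPoint, M, single_dotProduct, one_mul]
    exact ha k i
  refine ⟨f, ?_, ?_, ?_⟩
  · intro l hl s
    rw [hf']
    obtain ⟨q, hq, hq0⟩ := hQl ⟨l, hl⟩
    obtain ⟨Q', hQ'⟩ := Multiset.exists_cons_of_mem hq
    -- A form vanishing at the point is a multiple of `ε` on the jet, so its square is zero.
    have h7 : (linEval q (jetPoint (v l) (a l) s (idx ⟨l, hl⟩))) ^ 2 = 0 := by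
      have : (linEval q (jetPoint (v l) (a l) s (idx ⟨l, hl⟩))).fst = 0 := by
        rw [fst_linEval_jetPoint]; exact hq0
      rw [pow_two]
      ext <;> simp [this]
    rw [Finset.prod_eq_zero (Finset.mem_univ (idx ⟨l, hl⟩)), mul_zero, snd_zero]
    simp only [R]
    rw [hQ', Multiset.map_cons, Multiset.prod_cons, mul_pow, h7]
    ring
  · rw [hf']
    rcases t with _ | ⟨j, b⟩
    -- Radially only the scalar moves: every linear form is constant, whatever the characteristic.
    · have h8 : ∀ i (l : Fin (n i + 1) → K),
          linEval l (jetPoint (v k) (a k) none i) ∈ (inlHom K K).range := by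
        intro i l
        refine ⟨l ⬝ᵥ v k i, ?_⟩
        ext
        · simp [fst_linEval_jetPoint]
        · simp [snd_linEval_jetPoint, direction]
      obtain ⟨p, hp⟩ : ∏ i, (linEval (N i) (jetPoint (v k) (a k) none i) *
          R i (jetPoint (v k) (a k) none i)) ∈ (inlHom K K).range := by
        refine prod_mem fun i _ => mul_mem (h8 i _) (mul_mem (pow_mem ?_ _) (pow_mem (h8 i _) _))
        refine multiset_prod_mem _ fun x hx => ?_
        obtain ⟨l, -, rfl⟩ := Multiset.mem_map.mp hx
        exact h8 i l
      have hp0 : p ≠ 0 := by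
        have h9 := congrArg (fstHom K K K) hp
        simp only [map_prod, map_mul, fstHom_apply, inlHom_apply, fst_inl] at h9
        rw [h9]
        exact Finset.prod_ne_zero_iff.mpr fun i _ => mul_ne_zero (hM none i) (hR none i)
      rw [← hp]
      simpa [jetScalar] using hp0
    · have h8 : linEval (N j) (jetPoint (v k) (a k) (some ⟨j, b⟩) j) = inr 1 := by
        ext
        · simp [fst_linEval_jetPoint, N, sub_dotProduct, ha k j]
        · simp [snd_linEval_jetPoint, N, direction, Fin.succAbove_ne]
      rw [← Finset.mul_prod_erase _ _ (Finset.mem_univ j), h8]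
      have h9 : (∏ i ∈ Finset.univ.erase j,
          (linEval (N i) (jetPoint (v k) (a k) (some ⟨j, b⟩) i) *
          R i (jetPoint (v k) (a k) (some ⟨j, b⟩) i))).fst ≠ 0 := by
        rw [← fstHom_apply K K, map_prod]
        refine Finset.prod_ne_zero_iff.mpr fun i hi => ?_
        have hN : N i = M i := by simp [N, Finset.ne_of_mem_erase hi]
        rw [hN, fstHom_apply, fst_mul]
        exact mul_ne_zero (hM _ i) (hR _ i)
      simpa [jetScalar, hc k] using ⟨hR (some ⟨j, b⟩) j, h9⟩
  · intro ht s hs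
    rw [hf']
    rcases t with _ | ⟨j, b⟩
    · exact absurd rfl ht
    · have h8 : linEval (N j) (jetPoint (v k) (a k) s j) = 0 := by
        ext
        · simp [fst_linEval_jetPoint, N, sub_dotProduct, ha k j]
        · rcases s with _ | ⟨j', b'⟩
          · simp [snd_linEval_jetPoint, direction]
          · rw [snd_linEval_jetPoint]
            by_cases hj : j' = j
            · subst hj
              have hb : b ≠ b' := by rintro rfl; exact hs rfl
              simp [N, direction, Fin.succAbove_ne, hb]
            · simp [direction, hj]
      rw [Finset.prod_eq_zero (Finset.mem_univ j) (by rw [h8, zero_mul]), mul_zero, snd_zero]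

/-- Few distinct points of a Segre-Veronese variety have independent tangent spaces. -/
theorem linearIndependent_tangentVector {ι : Type*} [Fintype ι] (d : Fin r → ℕ)
    (hd : ∀ i, 2 * Fintype.card ι ≤ d i + 1)
    (c : ι → K) (hc : ∀ k, c k ≠ 0) (v : ι → (i : Fin r) → Fin (n i + 1) → K)
    (hv : ∀ k i, v k i ≠ 0)
    (hdist : ∀ k l, k ≠ l → ∃ i, Projectivization.mk K (v k i) (hv k i) ≠
      Projectivization.mk K (v l i) (hv l i))
    (a : ι → (i : Fin r) → Fin (n i + 1)) (ha : ∀ k i, v k i (a k i) ≠ 0) :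
    LinearIndependent K (fun p : ι × Option (Σ i, Fin (n i)) =>
      tangentVector d (c p.1) (v p.1) (a p.1) p.2) := by
  rw [Fintype.linearIndependent_iff]
  intro g hg
  -- The radial functional need not kill the other directions, so their coefficients are eliminated
  -- first.
  have main : ∀ k t, (t = none → ∀ s ≠ t, g (k, s) = 0) → g (k, t) = 0 := by
    intro k t ht
    obtain ⟨f, hf1, hf2, hf3⟩ :=
      exists_separating_functional d hd c hc v hv hdist a ha k t
    have h1 := congrArg f hg
    rw [map_sum, map_zero, Finset.sum_eq_single (k, t)] at h1
    · rw [map_smul, smul_eq_mul] at h1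
      exact (mul_eq_zero.mp h1).resolve_right hf2
    · rintro ⟨l, s⟩ - hne
      rw [map_smul, smul_eq_mul]
      by_cases hl : l = k
      · subst hl
        have hs : s ≠ t := by rintro rfl; exact hne rfl
        by_cases h0 : t = none
        · rw [ht h0 s hs, zero_mul]
        · rw [hf3 h0 s hs, mul_zero]
      · rw [hf1 l hl s, mul_zero]
    · intro h; exact absurd (Finset.mem_univ _) h
  have hsome : ∀ k t, g (k, some t) = 0 := fun k t => main k (some t) (by simp)
  rintro ⟨k, t⟩
  cases t with
  | some t => exact hsome k t
  | none =>
    refine main k none fun _ s hs => ?_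
    obtain ⟨t, rfl⟩ := Option.ne_none_iff_exists'.mp hs
    exact hsome k t

end Jets

end Terracini

/-! ### Tangent vectors lie in the tangent space -/

namespace Terracini

open TrivSqZeroExt MvPolynomial

/-- First-order Taylor expansion: it turns vanishing over the dual numbers into the equations
defining `tangentSpace`. -/
theorem snd_aeval_dualNumber {K σ : Type*} [Field K] [Fintype σ] (x : σ → DualNumber K)
    (F : MvPolynomial σ K) :
    (aeval x F).fst = eval (fun j => (x j).fst) F ∧
      (aeval x F).snd = ∑ j, (x j).snd * eval (fun j => (x j).fst) (pderiv j F) := by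
  induction F using MvPolynomial.induction_on with
  | C a => simp [TrivSqZeroExt.algebraMap_eq_inl]
  | add p q hp hq =>
    simp [hp.1, hp.2, hq.1, hq.2, mul_add, Finset.sum_add_distrib]
  | mul_X p j hp =>
    classical
    refine ⟨by simp [hp.1], ?_⟩
    simp only [map_mul, aeval_X, DualNumber.snd_mul, hp.1, hp.2, Derivation.leibniz, pderiv_X,
      smul_eq_mul, map_add, eval_X, mul_add, Finset.sum_add_distrib]
    congr 1
    · rw [Finset.sum_eq_single j] <;> simp +contextual [mul_comm]
    · rw [Finset.sum_mul]
      exact Finset.sum_congr rfl fun i _ => by ring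

section SegreVeronese

variable {K : Type*} [Field K] {r : ℕ} {n d : Fin r → ℕ}

theorem smul_monomials_mem_affineCone (hd : ∀ i, 1 ≤ d i) (s : K)
    (y : (i : Fin r) → Fin (n i + 1) → K) :
    (fun e => s * monomials d y e) ∈ affineCone (segreVeronese K n d) := by
  intro h0
  have hs : s ≠ 0 := by
    rintro rfl
    exact h0 (funext fun e => by simp)
  have hy : ∀ i, y i ≠ 0 := by
    intro i hi
    refine h0 (funext fun e => ?_)
    have : monomials d y e = 0 := by
      refine Finset.prod_eq_zero (Finset.mem_univ i) ?_
      rw [hi]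
      change (Multiset.map (fun _ => (0 : K)) (e i : Multiset (Fin (n i + 1)))).prod = 0
      rw [Multiset.map_const', Multiset.prod_replicate, Sym.card_coe]
      -- Positivity of `d i` matters here, as `0 ^ 0 = 1`.
      exact zero_pow (by have := hd i; omega)
    simp [this]
  refine ⟨fun i => Projectivization.mk K (y i) (hy i), ?_⟩
  choose u hu using fun i => Projectivization.exists_smul_eq_mk_rep K (y i) (hy i)
  rw [segreVeroneseMap, Projectivization.mk_eq_mk_iff']
  refine ⟨(∏ i, (u i : K) ^ d i) / s, funext fun e => ?_⟩
  have h1 : monomialVector d (fun i => (Projectivization.mk K (y i) (hy i)).rep) e =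
      monomials d (fun i b => (u i : K) * y i b) e := by
    congr 1
    funext i
    rw [← hu i]
    rfl
  rw [h1, monomials_mul]
  simp only [Pi.smul_apply, smul_eq_mul]
  field_simp

theorem exists_smul_monomials_of_mem_affineCone {z : Monomials n d → K}
    (hz : z ∈ affineCone (segreVeronese K n d)) (hz0 : z ≠ 0) :
    ∃ (s : K) (y : (i : Fin r) → Fin (n i + 1) → K), z = fun e => s * monomials d y e := by
  obtain ⟨p, hp⟩ := hz hz0
  rw [segreVeroneseMap, Projectivization.mk_eq_mk_iff'] at hp
  obtain ⟨s, hs⟩ := hp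
  by_cases h0 : s = 0
  · subst h0
    rw [zero_smul] at hs
    exact absurd hs.symm (monomialVector_ne_zero d _ fun i => (p i).rep_nonzero)
  refine ⟨s⁻¹, fun i => (p i).rep, funext fun e => ?_⟩
  have := congrFun hs e
  simp only [Pi.smul_apply, smul_eq_mul] at this
  change z e = s⁻¹ * monomialVector d _ e
  rw [← this, inv_mul_cancel_left₀ h0]

theorem eval_smul_monomials_eq_zero (hd : ∀ i, 1 ≤ d i) {F : MvPolynomial (Monomials n d) K}
    (hF : F ∈ idealOf (segreVeronese K n d)) (s : K) (y : (i : Fin r) → Fin (n i + 1) → K) :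
    eval (fun e => s * monomials d y e) F = 0 := by
  have := mem_vanishingIdeal_iff.mp hF _ (smul_monomials_mem_affineCone hd s y)
  rwa [aeval_eq_eval] at this

/-- The image of a polynomial under the universal parametrisation of the affine cone. -/
noncomputable def pullback (F : MvPolynomial (Monomials n d) K) :
    MvPolynomial (Option (Σ i, Fin (n i + 1))) K :=
  aeval (fun e => X none * monomials d (fun i b => X (some ⟨i, b⟩)) e) F

theorem aeval_pullback (F : MvPolynomial (Monomials n d) K) {A : Type*} [CommRing A] [Algebra K A]
    (x : Option (Σ i, Fin (n i + 1)) → A) :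
    aeval x (pullback F) =
      aeval (fun e => x none * monomials d (fun i b => x (some ⟨i, b⟩)) e) F := by
  rw [pullback, comp_aeval_apply]
  simp [map_monomials]

/-- Over an infinite field, a polynomial vanishing on the variety vanishes at all points of the
variety with values in `K`-algebras. -/
theorem aeval_mul_monomials_eq_zero [Infinite K] (hd : ∀ i, 1 ≤ d i)
    {F : MvPolynomial (Monomials n d) K} (hF : F ∈ idealOf (segreVeronese K n d))
    {A : Type*} [CommRing A] [Algebra K A] (s : A) (y : (i : Fin r) → Fin (n i + 1) → A) :
    aeval (fun e => s * monomials d y e) F = 0 := by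
  have hP : pullback F = 0 := by
    refine MvPolynomial.funext fun w => ?_
    rw [map_zero, ← aeval_eq_eval, aeval_pullback, aeval_eq_eval]
    exact eval_smul_monomials_eq_zero hd hF (w none) fun i b => w (some ⟨i, b⟩)
  have h1 := aeval_pullback F fun o : Option (Σ i, Fin (n i + 1)) =>
    o.elim s fun t => y t.1 t.2
  rw [hP, map_zero] at h1
  exact h1.symm

theorem tangentVector_mem_tangentSpace [Infinite K] (hd : ∀ i, 1 ≤ d i)
    (x : ℙ K (Monomials n d → K)) (c : K) (v : (i : Fin r) → Fin (n i + 1) → K)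
    (hx : x.rep = fun e => c * monomials d v e) (a : (i : Fin r) → Fin (n i + 1))
    (t : Option (Σ i, Fin (n i))) :
    tangentVector d c v a t ∈ tangentSpace (segreVeronese K n d) x := by
  intro F hF
  have h1 := aeval_mul_monomials_eq_zero hd hF (jetScalar c t) (jetPoint v a t)
  have h2 := (snd_aeval_dualNumber
    (fun e => jetScalar c t * monomials d (jetPoint v a t) e) F).2
  rw [h1, snd_zero] at h2
  rw [h2, hx]
  refine Finset.sum_congr rfl fun e _ => ?_
  congr 3
  funext e'
  have h3 := map_monomials (fstHom K K K) d (jetPoint v a t) e'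
  simp only [fstHom_apply] at h3
  simp [h3, fst_jetScalar, jetPoint]

end SegreVeronese

end Terracini

/-! ### Dimension bound and conclusion -/

namespace Terracini

open MvPolynomial

section SegreVeronese

variable {K : Type*} [Field K] {r : ℕ} {n d : Fin r → ℕ}

/-- The parametrisation of the affine cone by a scalar and the standard affine chart. -/
noncomputable def chartHom (K : Type*) [Field K] {r : ℕ} (n d : Fin r → ℕ) :
    MvPolynomial (Monomials n d) K →ₐ[K] MvPolynomial (Option (Σ i, Fin (n i))) K :=
  aeval fun e => X none * monomials d
    (fun i => (Fin.cons 1 fun b => X (some ⟨i, b⟩) :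
      Fin (n i + 1) → MvPolynomial (Option (Σ i, Fin (n i))) K)) e

/-- The standard chart is dense: dividing by the zeroth coordinates and absorbing their powers into
the scalar reduces to it. Multiplying by these coordinates handles the points outside. -/
theorem pullback_eq_zero_of_chartHom_eq_zero [Infinite K] {F : MvPolynomial (Monomials n d) K}
    (hF : chartHom K n d F = 0) : pullback F = 0 := by
  have h1 : pullback F * ∏ i, X (some ⟨i, 0⟩) = 0 := by
    refine MvPolynomial.funext fun w => ?_
    rw [map_mul, map_prod, map_zero, mul_eq_zero]
    by_cases h0 : ∀ i, w (some ⟨i, 0⟩) ≠ 0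
    · left
      let u : Option (Σ i, Fin (n i)) → K := fun o =>
        o.elim (w none * ∏ i, w (some ⟨i, 0⟩) ^ d i)
          fun t => w (some ⟨t.1, t.2.succ⟩) / w (some ⟨t.1, 0⟩)
      have h2 := congrArg (aeval u) hF
      rw [map_zero, chartHom, comp_aeval_apply] at h2
      rw [← aeval_eq_eval, aeval_pullback, ← h2]
      congr 2
      funext e
      rw [map_mul, map_monomials, aeval_X]
      simp only [u, Option.elim_none]
      rw [mul_assoc, ← monomials_mul]
      congr 2
      funext i b
      refine Fin.cases ?_ (fun b => ?_) b
      · simp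
      · simp [mul_div_cancel₀, h0 i]
    · right
      push Not at h0
      obtain ⟨i, hi⟩ := h0
      exact Finset.prod_eq_zero (Finset.mem_univ i) (by simpa using hi)
  exact (mul_eq_zero.mp h1).resolve_right (Finset.prod_ne_zero_iff.mpr fun i _ => X_ne_zero _)

theorem chartHom_eq_zero_iff [Infinite K] (hd : ∀ i, 1 ≤ d i) (F : MvPolynomial (Monomials n d) K) :
    chartHom K n d F = 0 ↔ F ∈ idealOf (segreVeronese K n d) := by
  refine ⟨fun hF => mem_vanishingIdeal_iff.mpr fun z hz => ?_,
    fun hF => aeval_mul_monomials_eq_zero hd hF _ _⟩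
  obtain ⟨s, y, rfl⟩ : ∃ (s : K) (y : (i : Fin r) → Fin (n i + 1) → K),
      z = fun e => s * monomials d y e := by
    by_cases hz0 : z = 0
    · exact ⟨0, 0, by simp [hz0]; rfl⟩
    · exact exists_smul_monomials_of_mem_affineCone hz hz0
  have h1 := aeval_pullback F fun o : Option (Σ i, Fin (n i + 1)) =>
    o.elim s fun t => y t.1 t.2
  rw [pullback_eq_zero_of_chartHom_eq_zero hF, map_zero] at h1
  exact h1.symm

/-- The coordinate ring embeds, through the chart, in a polynomial ring in `∑ n i + 1` variables. -/
theorem projDim_segreVeronese_le [Infinite K] (hd : ∀ i, 1 ≤ d i) :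
    projDim (segreVeronese K n d) ≤ ∑ i, (n i : ℤ) := by
  have h1 : Algebra.trdeg K (MvPolynomial (Monomials n d) K ⧸ idealOf (segreVeronese K n d)) ≤
      Algebra.trdeg K (MvPolynomial (Option (Σ i, Fin (n i))) K) := by
    refine trdeg_le_of_injective (Ideal.Quotient.liftₐ _ (chartHom K n d)
      fun F hF => (chartHom_eq_zero_iff hd F).mpr hF) ?_
    rw [injective_iff_map_eq_zero]
    intro q
    obtain ⟨F, rfl⟩ := Ideal.Quotient.mk_surjective q
    intro hF
    exact Ideal.Quotient.eq_zero_iff_mem.mpr ((chartHom_eq_zero_iff hd F).mp hF)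
  rw [MvPolynomial.trdeg_of_isDomain, Cardinal.mk_fintype, Cardinal.lift_natCast] at h1
  have h2 := Cardinal.toNat_le_toNat h1 Cardinal.natCast_lt_aleph0
  rw [Cardinal.toNat_natCast, Fintype.card_option, Fintype.card_sigma] at h2
  simp only [Fintype.card_fin] at h2
  rw [projDim]
  zify at h2
  linarith

theorem two_mul_le_of_le_ceil {h m : ℕ} (hh : h ≤ ⌈(m : ℚ) / 2⌉₊) : 2 * h ≤ m + 1 := by
  have h1 : ⌈(m : ℚ) / 2⌉₊ ≤ (m + 1) / 2 := by
    rw [Nat.ceil_le, div_le_iff₀ two_pos]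
    exact_mod_cast (by omega : m ≤ (m + 1) / 2 * 2)
  omega

/-- The span of the tangent spaces at few distinct points has the expected dimension. -/
theorem le_finrank_iSup_tangentSpace [Infinite K] (hd : ∀ i, 1 ≤ d i)
    (T : Finset (segreVeronese K n d)) (hT : ∀ i, 2 * T.card ≤ d i + 1) :
    T.card * (∑ i, n i + 1) ≤ Module.finrank K
      (⨆ x ∈ T, tangentSpace (segreVeronese K n d) (x : ℙ K (Monomials n d → K)) :
        Submodule K (Monomials n d → K)) := by
  choose p hp using fun x : T => x.1.2
  choose u hu using fun x : T => Projectivization.exists_smul_eq_mk_rep K _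
    (monomialVector_ne_zero d (fun i => (p x i).rep) fun i => (p x i).rep_nonzero)
  choose a ha using fun (x : T) i => Function.ne_iff.mp (p x i).rep_nonzero
  have hrep : ∀ x : T, (x : ℙ K (Monomials n d → K)).rep =
      fun e => (u x : K) * monomials d (fun i => (p x i).rep) e := by
    intro x
    rw [← hp x]
    exact (hu x).symm
  have hli := linearIndependent_tangentVector d (ι := T) (by simpa using hT)
    (fun x => (u x : K)) (fun x => (u x).ne_zero) (fun x i => (p x i).rep)
    (fun x i => (p x i).rep_nonzero)
    (fun x y hxy => by
      by_contra! H
      simp only [Projectivization.mk_rep] at H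
      exact hxy (Subtype.ext (Subtype.ext (by rw [← hp x, ← hp y, funext H])))) a ha
  have hspan := finrank_span_eq_card hli
  have hcard : Fintype.card (T × Option (Σ i, Fin (n i))) = T.card * (∑ i, n i + 1) := by
    simp
  rw [← hcard, ← hspan]
  refine Submodule.finrank_mono (Submodule.span_le.mpr ?_)
  rintro _ ⟨⟨x, t⟩, rfl⟩
  refine SetLike.mem_coe.mpr (Submodule.mem_iSup_of_mem x.1 (Submodule.mem_iSup_of_mem x.2 ?_))
  exact tangentVector_mem_tangentSpace hd _ _ _ (hrep x) _ _

end SegreVeronese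

end Terracini

theorem corollary4p3 {K : Type*} [Field K] [IsAlgClosed K] (r : ℕ) (n d : Fin r → ℕ)
    (hn : ∀ i, 1 ≤ n i) (hd : ∀ i, 1 ≤ d i) (h : ℕ)
    (hh : ∀ i, h ≤ ⌈(d i : ℚ) / 2⌉₊) :
    Terracini.terraciniLocus (Terracini.segreVeronese K n d) h = ∅ := by
  have := IsAlgClosed.instInfinite (K := K)
  rw [Terracini.terraciniLocus]
  suffices H : Terracini.openTerraciniLocus (Terracini.segreVeronese K n d) h = ∅ by
    rw [H, @closure_empty _ (Terracini.zariskiSym _ _)]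
  refine Set.eq_empty_of_forall_notMem ?_
  rintro s ⟨hs, hlt⟩
  let T : Finset (Terracini.segreVeronese K n d) := ⟨(s : Multiset _), hs⟩
  have hTc : T.card = h := s.2
  have h1 := Terracini.le_finrank_iSup_tangentSpace hd T fun i => by
    rw [hTc]; exact Terracini.two_mul_le_of_le_ceil (hh i)
  have h2 := Terracini.projDim_segreVeronese_le (K := K) (n := n) hd
  -- The first entry of the minimum alone gives the contradiction.
  have h3 := lt_of_lt_of_le hlt (min_le_left _ _)
  rw [Terracini.linDim] at h3
  change (Module.finrank K (⨆ x ∈ T, Terracini.tangentSpace (Terracini.segreVeronese K n d)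
    (x : ℙ K (Terracini.Monomials n d → K)) : Submodule K _) : ℤ) - 1 < _ at h3
  rw [hTc] at h1
  zify at h1
  have h4 := mul_le_mul_of_nonneg_left h2 (Int.natCast_nonneg h)
  linarith
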